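/- Let $F$ be a field (for example a subfield of $\overline{\mathbb{Q}}$), let $n\ge 1$, let $\lambda_1,\dots,\lambda_n,c\in F\setminus\{0\}$, and let $\sigma$ be the automorphism of the rational function field $F(\alpha_1,\dots,\alpha_n)$ with $\sigma|_F=\mathrm{id}$ and $\sigma(\alpha_i)=\lambda_i\alpha_i$ for all $i$. Put $G=\langle\sigma\rangle$ and $K=F(\alpha_1,\dots,\alpha_{n-1})$. For polynomials $p,q\in F[\alpha_1,\dots,\alpha_n]$ write $p\sim_\sigma q$ if $\sigma^k(p)=uq$ for some $k\in\mathbb{Z}$ and $u\in F\setminus\{0\}$, and let $[p]_G$ denote the class of $p$ under this equivalence relation. For $i\in\mathbb{Z}$ let $V_i=K\alpha_n^i$. For an irreducible $d\in F[\alpha_1,\dots,\alpha_n]$ with $\deg_{\alpha_n}(d)\ge 1$ and $d\not\sim_\sigma\alpha_n$, and for an integer $j\ge 1$, let $$V_{[d]_G,j}=\operatorname{span}_K\left\{\frac{a}{\theta(d)^j}\;\middle|\; a\in K[\alpha_n],\ \theta\in G,\ \deg_{\alpha_n}(a)<\deg_{\alpha_n}(d)\right\};$$ this depends only on $[d]_G$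 and $j$. Let $\Omega$ be the disjoint union of $\mathbb{Z}$ and the set of all pairs $([d]_G,j)$ with $d$ and $j$ as above. Let $f\in F(\alpha_1,\dots,\alpha_n)$. Then $f$ has a unique orbital partial fraction decomposition $f=\sum_{\omega\in\Omega}f_\omega$ with $f_\omega\in V_\omega$ for all $\omega\in\Omega$ and $f_\omega=0$ for all but finitely many $\omega$. Moreover, for this decomposition the following are equivalent: 1. $f$ is $c\sigma$-summable in $F(\alpha_1,\dots,\alpha_n)$, that is, $f=c\,\sigma(g)-g$ for some $g\in F(\alpha_1,\dots,\alpha_n)$; 2. for every $\omega\in\Omega$, $f_\omega$ is $c\sigma$-summable in $V_\omega$, that is, $f_\omega=c\,\sigma(g_\omega)-g_\omega$ for some $g_\omega\in V_\omega$. -/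

import Mathlib

open scoped Polynomial

noncomputable section

namespace DiffField

variable {F : Type*} [Field F] {m : ℕ}

/-- The polynomial ring `F[α₁, …, αₙ]`, where `n = m + 1`. -/
abbrev Poly (F : Type*) [Field F] (m : ℕ) : Type _ := MvPolynomial (Fin (m + 1)) F

/-- The field of rational functions `F(α₁, …, αₙ)`, where `n = m + 1`. -/
abbrev RatField (F : Type*) [Field F] (m : ℕ) : Type _ := FractionRing (Poly F m)

/-- The variable `αᵢ`, as an element of `F(α₁, …, αₙ)`. -/
def alpha (F : Type*) [Field F] (m : ℕ) (i : Fin (m + 1)) : RatField F m :=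
  algebraMap (Poly F m) (RatField F m) (MvPolynomial.X i)

/-- The last variable `αₙ`, as an element of `F(α₁, …, αₙ)`. -/
abbrev alphaLast (F : Type*) [Field F] (m : ℕ) : RatField F m := alpha F m (Fin.last m)

/-- The subfield `F(α₁, …, αₙ₋₁)` of `F(α₁, …, αₙ)`. -/
def Base (F : Type*) [Field F] (m : ℕ) : IntermediateField F (RatField F m) :=
  IntermediateField.adjoin F (Set.range fun i : Fin m => alpha F m i.castSucc)

/-- The `F`-automorphism `αᵢ ↦ λᵢ αᵢ` of `F[α₁, …, αₙ]`. -/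
def sigmaPoly (lam : Fin (m + 1) → Fˣ) : Poly F m ≃ₐ[F] Poly F m :=
  AlgEquiv.ofAlgHom
    (MvPolynomial.aeval fun i => MvPolynomial.C (lam i : F) * MvPolynomial.X i)
    (MvPolynomial.aeval fun i => MvPolynomial.C ((lam i)⁻¹ : Fˣ).val * MvPolynomial.X i)
    (by
      ext i : 1
      simp [← mul_assoc, MvPolynomial.algebraMap_eq, ← MvPolynomial.C_mul])
    (by
      ext i : 1
      simp [← mul_assoc, MvPolynomial.algebraMap_eq, ← MvPolynomial.C_mul])

/-- The `F`-automorphism `σ : αᵢ ↦ λᵢ αᵢ` of `F(α₁, …, αₙ)`. -/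
def sigma (lam : Fin (m + 1) → Fˣ) : RatField F m ≃ₐ[F] RatField F m :=
  IsFractionRing.fieldEquivOfAlgEquiv F (RatField F m) (RatField F m) (sigmaPoly lam)

theorem sigma_algebraMap (lam : Fin (m + 1) → Fˣ) (p : Poly F m) :
    sigma lam (algebraMap (Poly F m) (RatField F m) p) =
      algebraMap (Poly F m) (RatField F m) (sigmaPoly lam p) := by
  simp [sigma]

theorem sigma_alpha (lam : Fin (m + 1) → Fˣ) (i : Fin (m + 1)) :
    sigma lam (alpha F m i) = (lam i : F) • alpha F m i := by
  rw [alpha, sigma_algebraMap]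
  simp [sigmaPoly, Algebra.smul_def, IsScalarTower.algebraMap_apply F (Poly F m) (RatField F m),
    MvPolynomial.algebraMap_eq]

/-- The spread set `Spr_σ(p, q) = {k ∈ ℤ | σᵏ(p) = u q for some nonzero u ∈ F}`. -/
def Spr (lam : Fin (m + 1) → Fˣ) (p q : Poly F m) : Set ℤ :=
  {k | ∃ u : Fˣ, (sigmaPoly lam ^ k) p = (u : F) • q}

/-- The equivalence `p ∼_σ q` of polynomials. -/
def SigmaEquiv (lam : Fin (m + 1) → Fˣ) (p q : Poly F m) : Prop := (Spr lam p q).Nonempty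

theorem SigmaEquiv.refl (lam : Fin (m + 1) → Fˣ) (p : Poly F m) : SigmaEquiv lam p p :=
  ⟨0, 1, by simp⟩

theorem SigmaEquiv.symm {lam : Fin (m + 1) → Fˣ} {p q : Poly F m} (h : SigmaEquiv lam p q) :
    SigmaEquiv lam q p := by
  obtain ⟨k, u, h⟩ := h
  refine ⟨-k, u⁻¹, ?_⟩
  have h2 : q = ((u⁻¹ : Fˣ) : F) • (sigmaPoly lam ^ k) p := by
    rw [h, smul_smul]; simp
  rw [h2, map_smul, ← AlgEquiv.mul_apply, ← zpow_add]
  simp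

theorem SigmaEquiv.trans {lam : Fin (m + 1) → Fˣ} {p q r : Poly F m} (h : SigmaEquiv lam p q)
    (h' : SigmaEquiv lam q r) : SigmaEquiv lam p r := by
  obtain ⟨k, u, h⟩ := h
  obtain ⟨l, v, h'⟩ := h'
  refine ⟨l + k, u * v, ?_⟩
  rw [zpow_add, AlgEquiv.mul_apply, h, map_smul, h', smul_smul]
  simp

/-- The admissible denominators: irreducible `d ∈ F[α₁, …, αₙ]` of positive degree in `αₙ`
with `d ≁_σ αₙ`. -/
def Denom (lam : Fin (m + 1) → Fˣ) : Type _ :=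
  {d : Poly F m // Irreducible d ∧ 1 ≤ d.degreeOf (Fin.last m) ∧
    ¬ SigmaEquiv lam d (MvPolynomial.X (Fin.last m))}

instance denomSetoid (lam : Fin (m + 1) → Fˣ) : Setoid (Denom lam) where
  r d e := SigmaEquiv lam d.1 e.1
  iseqv := ⟨fun d => SigmaEquiv.refl lam d.1, SigmaEquiv.symm, SigmaEquiv.trans⟩

/-- The set of classes `[d]_G` of admissible denominators; `[d]_G = [e]_G` iff `d ∼_σ e`. -/
def Orbit (lam : Fin (m + 1) → Fˣ) : Type _ := Quotient (denomSetoid lam)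

/-- The index set `Ω`: the integers together with the pairs `([d]_G, j)`, `j ≥ 1`. -/
abbrev Omega (lam : Fin (m + 1) → Fˣ) : Type _ := ℤ ⊕ (Orbit lam × ℕ+)

/-- `V_i`, the `F(α₁, …, αₙ₋₁)`-span of `αₙ ^ i`. -/
def powerSpace (F : Type*) [Field F] (m : ℕ) (i : ℤ) : Submodule (Base F m) (RatField F m) :=
  Submodule.span (Base F m) {alphaLast F m ^ i}

/-- The space `V_{[d]_G, j}` of a polynomial `d`: the `F(α₁, …, αₙ₋₁)`-span of all fractions
`a / θ(d) ^ j` with `θ ∈ G = ⟨σ⟩` and `a ∈ F(α₁, …, αₙ₋₁)[αₙ]`, `deg a < deg d` in `αₙ`. -/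
def fracSpace (lam : Fin (m + 1) → Fˣ) (d : Poly F m) (j : ℕ+) :
    Submodule (Base F m) (RatField F m) :=
  Submodule.span (Base F m)
    {x | ∃ a : (Base F m)[X], ∃ θ ∈ Subgroup.zpowers (sigma lam),
      a.degree < (d.degreeOf (Fin.last m) : WithBot ℕ) ∧
      x = Polynomial.aeval (alphaLast F m) a /
        θ (algebraMap (Poly F m) (RatField F m) d) ^ (j : ℕ)}

theorem sigma_zpow_algebraMap (lam : Fin (m + 1) → Fˣ) (k : ℤ) (p : Poly F m) :
    (sigma lam ^ k) (algebraMap (Poly F m) (RatField F m) p) =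
      algebraMap (Poly F m) (RatField F m) ((sigmaPoly lam ^ k) p) := by
  have hn : ∀ (n : ℕ) (p : Poly F m), (sigma lam ^ n) (algebraMap (Poly F m) (RatField F m) p) =
      algebraMap (Poly F m) (RatField F m) ((sigmaPoly lam ^ n) p) := by
    intro n
    induction n with
    | zero => intro p; simp
    | succ n ih =>
      intro p
      rw [pow_succ, pow_succ, AlgEquiv.mul_apply, AlgEquiv.mul_apply, sigma_algebraMap, ih]
  obtain ⟨n, rfl | rfl⟩ := k.eq_nat_or_neg
  · simpa using hn n p
  · rw [zpow_neg, zpow_neg, zpow_natCast, zpow_natCast]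
    apply (sigma lam ^ n).injective
    rw [← AlgEquiv.mul_apply, mul_inv_cancel, hn, ← AlgEquiv.mul_apply, mul_inv_cancel]
    simp

theorem coeff_sigmaPoly (lam : Fin (m + 1) → Fˣ) (p : Poly F m) (s : Fin (m + 1) →₀ ℕ) :
    (sigmaPoly lam p).coeff s = (∏ i, (lam i : F) ^ s i) * p.coeff s := by
  induction p using MvPolynomial.induction_on' with
  | monomial t a =>
    have : sigmaPoly lam (MvPolynomial.monomial t a) =
        MvPolynomial.monomial t ((∏ i, (lam i : F) ^ t i) * a) := by
      simp only [sigmaPoly, AlgEquiv.ofAlgHom_apply, MvPolynomial.aeval_monomial, mul_pow]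
      rw [Finsupp.prod_mul, MvPolynomial.monomial_eq, MvPolynomial.algebraMap_eq,
        Finsupp.prod_fintype t (fun i k => (MvPolynomial.C (lam i : F)) ^ k) (by simp)]
      simp only [MvPolynomial.C_mul, map_prod, map_pow]
      ring
    rw [this]
    classical
    simp only [MvPolynomial.coeff_monomial]
    split_ifs with h
    · rw [h]
    · simp
  | add p q hp hq => rw [map_add, MvPolynomial.coeff_add, hp, hq, MvPolynomial.coeff_add]; ring

theorem degreeOf_sigmaPoly (lam : Fin (m + 1) → Fˣ) (p : Poly F m) (i : Fin (m + 1)) :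
    (sigmaPoly lam p).degreeOf i = p.degreeOf i := by
  have : (sigmaPoly lam p).support = p.support := by
    ext s
    simp [MvPolynomial.mem_support_iff, coeff_sigmaPoly, Finset.prod_eq_zero_iff]
  simp [MvPolynomial.degreeOf_eq_sup, this]

theorem degreeOf_sigmaPoly_zpow (lam : Fin (m + 1) → Fˣ) (k : ℤ) (p : Poly F m)
    (i : Fin (m + 1)) : ((sigmaPoly lam ^ k) p).degreeOf i = p.degreeOf i := by
  have hn : ∀ (n : ℕ) (p : Poly F m),
      ((sigmaPoly lam ^ n) p).degreeOf i = p.degreeOf i := by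
    intro n
    induction n with
    | zero => intro p; simp
    | succ n ih => intro p; rw [pow_succ, AlgEquiv.mul_apply, ih, degreeOf_sigmaPoly]
  obtain ⟨n, rfl | rfl⟩ := k.eq_nat_or_neg
  · simpa using hn n p
  · rw [← hn n ((sigmaPoly lam ^ (-(n : ℤ))) p), zpow_neg, zpow_natCast, ← AlgEquiv.mul_apply,
      mul_inv_cancel, AlgEquiv.one_apply]

theorem SigmaEquiv.degreeOf_eq {lam : Fin (m + 1) → Fˣ} {p q : Poly F m} (h : SigmaEquiv lam p q)
    (i : Fin (m + 1)) : p.degreeOf i = q.degreeOf i := by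
  obtain ⟨k, u, h⟩ := h
  rw [← degreeOf_sigmaPoly_zpow lam k p, h, MvPolynomial.smul_eq_C_mul]
  have : (MvPolynomial.C (u : F) * q).support = q.support := by
    ext s
    simp [MvPolynomial.mem_support_iff]
  simp [MvPolynomial.degreeOf_eq_sup, this]

theorem fracSpace_le {lam : Fin (m + 1) → Fˣ} {d e : Poly F m} (h : SigmaEquiv lam d e) (j : ℕ+) :
    fracSpace lam d j ≤ fracSpace lam e j := by
  refine Submodule.span_le.2 ?_
  rintro x ⟨a, θ, ⟨l, rfl⟩, ha, rfl⟩
  rw [h.degreeOf_eq] at ha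
  obtain ⟨k, u, hu⟩ := h.symm
  refine Submodule.subset_span
    ⟨Polynomial.C (algebraMap F (Base F m) (u : F) ^ (j : ℕ)) * a, sigma lam ^ (l + k),
      ⟨l + k, rfl⟩, by rwa [Polynomial.degree_C_mul (pow_ne_zero _ (by simp))], ?_⟩
  have hz : algebraMap F (RatField F m) (u : F) ≠ 0 := by simp
  have h1 : (sigma lam ^ (l + k)) (algebraMap (Poly F m) (RatField F m) e) =
      algebraMap F (RatField F m) (u : F) *
        (sigma lam ^ l) (algebraMap (Poly F m) (RatField F m) d) := by
    rw [zpow_add, AlgEquiv.mul_apply, sigma_zpow_algebraMap lam k, hu, Algebra.smul_def, map_mul,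
      ← IsScalarTower.algebraMap_apply, map_mul, AlgEquiv.commutes]
  have h2 : Polynomial.aeval (alphaLast F m)
      (Polynomial.C (algebraMap F (Base F m) (u : F) ^ (j : ℕ)) * a) =
      algebraMap F (RatField F m) (u : F) ^ (j : ℕ) * Polynomial.aeval (alphaLast F m) a := by
    rw [map_mul, Polynomial.aeval_C, map_pow, ← IsScalarTower.algebraMap_apply]
  rw [h1, h2, mul_pow, mul_div_mul_left _ _ (pow_ne_zero _ hz)]

/-- The space `V_{[d]_G, j}` of a class `[d]_G`; it does not depend on the representative. -/
def orbitSpace (lam : Fin (m + 1) → Fˣ) (O : Orbit lam) (j : ℕ+) :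
    Submodule (Base F m) (RatField F m) :=
  Quotient.lift (fun d : Denom lam => fracSpace lam d.1 j)
    (fun _ _ h => le_antisymm (fracSpace_le h j) (fracSpace_le (SigmaEquiv.symm h) j)) O

/-- The space `V_ω` for `ω ∈ Ω`. -/
def space (lam : Fin (m + 1) → Fˣ) : Omega lam → Submodule (Base F m) (RatField F m)
  | Sum.inl i => powerSpace F m i
  | Sum.inr (O, j) => orbitSpace lam O j

/-- The finitely supported family `φ` is an orbital partial fraction decomposition of `f`:
`f = ∑ φ_ω` with `φ_ω ∈ V_ω`. -/
def IsOrbitalDecomposition (lam : Fin (m + 1) → Fˣ) (f : RatField F m)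
    (φ : Omega lam →₀ RatField F m) : Prop :=
  (∀ ω, φ ω ∈ space lam ω) ∧ f = φ.sum fun _ x => x

/-- `f` is `cσ`-summable: `f = c σ(g) - g` for some rational function `g`. -/
def IsSummable (lam : Fin (m + 1) → Fˣ) (c : F) (f : RatField F m) : Prop :=
  ∃ g : RatField F m, f = c • sigma lam g - g

/-- `f` is `cσ`-summable in the space `V`: `f = c σ(g) - g` for some `g ∈ V`. -/
def IsSummableIn (lam : Fin (m + 1) → Fˣ) (c : F) (V : Submodule (Base F m) (RatField F m))
    (f : RatField F m) : Prop :=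
  ∃ g ∈ V, f = c • sigma lam g - g

end DiffField

end

/-! The map `g ↦ c • sigma lam g - g` is additive and sends every `V_ω` into itself: `σ` preserves
`K = F(α₁, …, αₙ₋₁)`, scales `αₙ`, and moves the denominators `θ(d)` within their orbit without
changing their degree in `αₙ` (`sigma_mem_space`). Once the field is known to be the direct sum of
the `V_ω`, the decomposition of `c σ(g) - g` is therefore obtained componentwise from that of `g`.
Uniqueness yields one implication; summing the local witnesses yields the other.

The direct sum rests on classical partial fractions over `K` in the transcendental element `αₙ`
(`iSupIndep_component`, `div_mem_iSup_component`). Gauss's lemma matches monic irreducibles of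
`K[αₙ]` with irreducibles of `F[α₁, …, αₙ]` of positive degree in `αₙ`, unique up to constants of
`F`. Each `V_ω` then lies in the sum of a block of components (`space_le`), distinct `ω` have
disjoint blocks (`fiber_disjoint`), and every component lies in some `V_ω` (`exists_component_le`).
-/

noncomputable section

/-! ### Partial fractions over a field in a transcendental element -/

namespace PartialFraction

open Polynomial

variable {K L : Type*} [Field K] [Field L] [Algebra K L]

/-- The monic irreducible polynomials over `K`. -/
abbrev MonicIrreducible (K : Type*) [Field K] : Type _ := {P : K[X] // P.Monic ∧ Irreducible P}

/-- The components of the partial fraction decomposition over `K` with respect to `α`. -/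
def component (α : L) : ℕ ⊕ (MonicIrreducible K × ℕ+) → Submodule K L
  | Sum.inl n => Submodule.span K {α ^ n}
  | Sum.inr (P, j) => (degreeLT K P.1.natDegree).map
      (LinearMap.mulRight K ((aeval α P.1 ^ (j : ℕ))⁻¹) ∘ₗ (aeval α).toLinearMap)

theorem mem_component_inr {α : L} {P : MonicIrreducible K} {j : ℕ+} {x : L} :
    x ∈ component α (Sum.inr (P, j)) ↔ ∃ a : K[X], a.degree < (P.1.natDegree : WithBot ℕ) ∧
      x = aeval α a / aeval α P.1 ^ (j : ℕ) := by
  simp [component, Submodule.mem_map, mem_degreeLT, div_eq_mul_inv, eq_comm]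

/-- The elements of `L` that can be written in `α` with denominator prime to `P`. -/
def regularAt (α : L) {P : K[X]} (hP : Prime P) : Submodule K L where
  carrier := {x | ∃ b : K[X], ¬ P ∣ b ∧ ∃ a : K[X], aeval α b * x = aeval α a}
  zero_mem' := ⟨1, hP.not_dvd_one, 0, by simp⟩
  add_mem' := by
    rintro x y ⟨b, hb, a, h⟩ ⟨b', hb', a', h'⟩
    refine ⟨b * b', fun hd => (hP.dvd_or_dvd hd).elim hb hb', b' * a + b * a', ?_⟩
    simp only [map_mul, map_add, ← h, ← h']
    ring
  smul_mem' := by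
    rintro c x ⟨b, hb, a, h⟩
    exact ⟨b, hb, c • a, by rw [mul_smul_comm, h, map_smul]⟩

theorem aeval_mul_mem_regularAt {α : L} {P : K[X]} (hP : Prime P) (q : K[X]) {x : L}
    (hx : x ∈ regularAt α hP) : aeval α q * x ∈ regularAt α hP := by
  obtain ⟨b, hb, a, h⟩ := hx
  exact ⟨b, hb, q * a, by rw [map_mul, ← h]; ring⟩

theorem aeval_mem_regularAt (α : L) {P : K[X]} (hP : Prime P) (q : K[X]) :
    aeval α q ∈ regularAt α hP :=
  ⟨1, hP.not_dvd_one, q, by simp⟩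

variable {α : L}

theorem aeval_ne_zero (hα : Transcendental K α) {p : K[X]} (hp : p ≠ 0) : aeval α p ≠ 0 :=
  fun h => hp ((transcendental_iff.1 hα) p h)

theorem MonicIrreducible.eq_of_dvd {P Q : MonicIrreducible K} (h : P.1 ∣ Q.1) : P = Q :=
  Subtype.ext (eq_of_monic_of_associated P.2.1 Q.2.1 (P.2.2.associated_of_dvd Q.2.2 h))

theorem div_mem_regularAt (hα : Transcendental K α) {P Q : MonicIrreducible K} (h : P ≠ Q)
    (a : K[X]) (j : ℕ) :
    aeval α a / aeval α Q.1 ^ j ∈ regularAt α P.2.2.prime := by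
  refine ⟨Q.1 ^ j, fun hd => h (MonicIrreducible.eq_of_dvd (P.2.2.prime.dvd_of_dvd_pow hd)), a, ?_⟩
  rw [map_pow, mul_div_cancel₀]
  exact pow_ne_zero _ (aeval_ne_zero hα Q.2.2.ne_zero)

/-- Clearing denominators gives `P ∣ b * a` with `P` prime to `b`, so `P ∣ a`, which the degree
bound forbids unless `a = 0`. -/
theorem eq_zero_of_div_mem_regularAt (hα : Transcendental K α) {P : MonicIrreducible K}
    {a : K[X]} (ha : a.degree < (P.1.natDegree : WithBot ℕ))
    (h : aeval α a / aeval α P.1 ∈ regularAt α P.2.2.prime) : a = 0 := by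
  obtain ⟨b, hb, c, h⟩ := h
  rw [mul_div_assoc', div_eq_iff (aeval_ne_zero hα P.2.2.ne_zero), ← map_mul, ← map_mul] at h
  have h' : b * a = c * P.1 := transcendental_iff_injective.1 hα h
  have hPa := (P.2.2.prime.dvd_or_dvd (Dvd.intro_left c h'.symm)).resolve_left hb
  refine eq_zero_of_dvd_of_degree_lt hPa ?_
  rwa [degree_eq_natDegree P.2.2.ne_zero]

/-- In a vanishing sum, take a nonzero term `a / P ^ j` of largest pole order at `P`. Multiplication
by `P ^ (j - 1)` makes all other terms regular at `P` and leaves `a / P`, so `a = 0`. With the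
fractional terms gone, only powers of `α` remain, independent by transcendence. -/
theorem iSupIndep_component (hα : Transcendental K α) :
    iSupIndep (component (K := K) α) := by
  classical
  rw [iSupIndep_iff_finsetSum_eq_zero_imp_eq_zero]
  intro s v hv h0
  have hfrac : ∀ y, Sum.inr y ∈ s → v (Sum.inr y) = 0 := by
    rintro ⟨P, j₀⟩ hs
    by_contra hne
    -- The value `0` on `Sum.inl` is a dummy: the filter keeps only indices `Sum.inr (P, j)`.
    obtain ⟨i, hi, hmax⟩ := Finset.exists_max_image
      (s.filter fun i => v i ≠ 0 ∧ ∃ j, i = Sum.inr (P, j))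
      (Sum.elim (fun _ => 0) (fun y => (y.2 : ℕ))) ⟨_, Finset.mem_filter.2 ⟨hs, hne, j₀, rfl⟩⟩
    simp only [Finset.mem_filter] at hi hmax
    obtain ⟨his, hvi, j, rfl⟩ := hi
    have hP0 : aeval α P.1 ≠ 0 := aeval_ne_zero hα P.2.2.ne_zero
    have hother : ∀ i ∈ s.erase (Sum.inr (P, j)),
        aeval α (P.1 ^ ((j : ℕ) - 1)) * v i ∈ regularAt α P.2.2.prime := by
      intro i hi
      obtain ⟨hij, his'⟩ := Finset.mem_erase.1 hi
      have hvi' := hv i his'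
      rcases i with n | ⟨Q, k⟩
      · obtain ⟨c, hc⟩ := Submodule.mem_span_singleton.1 hvi'
        refine aeval_mul_mem_regularAt _ _ ?_
        rw [← hc]
        simpa using (regularAt α P.2.2.prime).smul_mem c (aeval_mem_regularAt α _ (X ^ n))
      · obtain ⟨a, ha, hva⟩ := mem_component_inr.1 hvi'
        by_cases hPQ : P = Q
        · subst hPQ
          by_cases hvk : v (Sum.inr (P, k)) = 0
          · rw [hvk, mul_zero]
            exact zero_mem _
          have hkj : (k : ℕ) ≤ j := by simpa using hmax _ ⟨his', hvk, k, rfl⟩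
          have hkj' : (k : ℕ) ≠ j := fun h => hij (by rw [PNat.coe_injective h])
          obtain ⟨e, he⟩ := Nat.exists_eq_add_of_le (show (k : ℕ) ≤ j - 1 by omega)
          rw [hva, he, pow_add, map_mul, map_pow, map_pow]
          rw [show aeval α P.1 ^ (k : ℕ) * aeval α P.1 ^ e * (aeval α a / aeval α P.1 ^ (k : ℕ)) =
            aeval α (P.1 ^ e * a) by rw [map_mul, map_pow]; field_simp]
          exact aeval_mem_regularAt _ _ _
        · rw [hva]
          exact aeval_mul_mem_regularAt _ _ (div_mem_regularAt hα hPQ a k)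
    have hmem := (regularAt α P.2.2.prime).neg_mem (Submodule.sum_mem _ hother)
    rw [← Finset.mul_sum, ← mul_neg, ← eq_neg_of_add_eq_zero_left
      ((Finset.add_sum_erase s v his).trans h0)] at hmem
    obtain ⟨a, ha, hva⟩ := mem_component_inr.1 (hv _ his)
    have : aeval α (P.1 ^ ((j : ℕ) - 1)) * v (Sum.inr (P, j)) = aeval α a / aeval α P.1 := by
      obtain ⟨e, he⟩ := Nat.exists_eq_add_of_le' (show 1 ≤ (j : ℕ) from j.2)
      rw [hva, he, Nat.add_sub_cancel, map_pow]
      field_simp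
      ring
    rw [this] at hmem
    apply hvi
    rw [hva, eq_zero_of_div_mem_regularAt hα ha hmem, map_zero, zero_div]
  rintro (n | y) hi
  · rw [Finset.sum_sum_eq_sum_toLeft_add_sum_toRight,
      Finset.sum_eq_zero (s := s.toRight) fun y hy => hfrac y (Finset.mem_toRight.1 hy),
      add_zero] at h0
    have hlin : LinearIndependent K fun n : ℕ => α ^ n := by
      simpa [Function.comp_def] using (basisMonomials K).linearIndependent.map'
        (aeval α).toLinearMap (LinearMap.ker_eq_bot.2 (transcendental_iff_injective.1 hα))
    exact (iSupIndep_iff_finsetSum_eq_zero_imp_eq_zero _).1 hlin.iSupIndep_span_singleton s.toLeft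
      (fun n => v (Sum.inl n)) (fun n hn => hv _ (Finset.mem_toLeft.1 hn)) h0 n
      (Finset.mem_toLeft.2 hi)
  · exact hfrac y hi

/-- The numerators of fractions with associated denominators agree up to a constant. -/
theorem exists_div_eq_of_associated (hα : Transcendental K α) {P Q : K[X]} (h : Associated P Q)
    (hQ : Q ≠ 0) (a : K[X]) (j : ℕ) : ∃ b : K[X], b.degree = a.degree ∧
      aeval α a / aeval α P ^ j = aeval α b / aeval α Q ^ j := by
  obtain ⟨u, rfl⟩ := h
  refine ⟨u ^ j * a, ?_, ?_⟩
  · rw [degree_mul, degree_pow, degree_coe_units]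
    simp
  · have hP := aeval_ne_zero hα (left_ne_zero_of_mul hQ)
    have hu := aeval_ne_zero hα u.ne_zero
    simp only [map_mul, map_pow, mul_pow]
    field_simp

theorem aeval_mem_iSup_component (p : K[X]) : aeval α p ∈ ⨆ i, component (K := K) α i := by
  rw [aeval_eq_sum_range]
  exact Submodule.sum_mem _ fun n _ => Submodule.smul_mem _ _
    (Submodule.mem_iSup_of_mem (Sum.inl n) (Submodule.mem_span_singleton_self _))

theorem exists_monicIrreducible {P : K[X]} (hP : Irreducible P) :
    ∃ Q : MonicIrreducible K, Associated Q.1 P := by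
  have hu : IsUnit (C P.leadingCoeff⁻¹) :=
    isUnit_C.2 (isUnit_iff_ne_zero.2 (inv_ne_zero (leadingCoeff_ne_zero.2 hP.ne_zero)))
  have h : Associated (P * C P.leadingCoeff⁻¹) P := associated_mul_unit_left P _ hu
  exact ⟨⟨_, monic_mul_leadingCoeff_inv hP.ne_zero, h.irreducible_iff.2 hP⟩, h⟩

/-- Division of `p` by `Q` leaves a remainder of admissible degree over the top power of `Q`; the
quotient has a pole of order one less. -/
theorem div_pow_mem_iSup_component (hα : Transcendental K α) (Q : MonicIrreducible K) (j : ℕ)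
    (p : K[X]) : aeval α p / aeval α Q.1 ^ j ∈ ⨆ i, component (K := K) α i := by
  induction j generalizing p with
  | zero => simpa using aeval_mem_iSup_component p
  | succ j ih =>
    have hQ0 : aeval α Q.1 ≠ 0 := aeval_ne_zero hα Q.2.2.ne_zero
    have h : aeval α p / aeval α Q.1 ^ (j + 1) = aeval α (p /ₘ Q.1) / aeval α Q.1 ^ j +
        aeval α (p %ₘ Q.1) / aeval α Q.1 ^ (j + 1) := by
      conv_lhs => rw [← modByMonic_add_div p Q.1]
      simp only [map_add, map_mul]
      field_simp
      ring
    rw [h]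
    refine add_mem (ih _) (Submodule.mem_iSup_of_mem (Sum.inr (Q, j.succPNat))
      (mem_component_inr.2 ⟨_, ?_, rfl⟩))
    rw [← degree_eq_natDegree Q.2.2.ne_zero]
    exact degree_modByMonic_lt _ Q.2.1

/-- A Bézout relation splits a fraction with coprime factors in its denominator, which reduces to
prime powers. -/
theorem div_mem_iSup_component (hα : Transcendental K α) (q p : K[X]) :
    aeval α p / aeval α q ∈ ⨆ i, component (K := K) α i := by
  induction q using UniqueFactorizationMonoid.induction_on_coprime generalizing p with
  -- Division by zero gives zero here.
  | h0 => simp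
  | @h1 u hu =>
    obtain ⟨v, hv⟩ := hu.exists_right_inv
    have : aeval α p / aeval α u = aeval α (p * v) := by
      rw [div_eq_iff (aeval_ne_zero hα hu.ne_zero), ← map_mul, mul_assoc, mul_comm v, hv, mul_one]
    rw [this]
    exact aeval_mem_iSup_component _
  | @hpr P j hP =>
    obtain ⟨Q, hQ⟩ := exists_monicIrreducible hP.irreducible
    obtain ⟨b, -, h⟩ := exists_div_eq_of_associated hα hQ.symm Q.2.2.ne_zero p j
    rw [map_pow, h]
    exact div_pow_mem_iSup_component hα Q j b
  | @hcp x y hxy hx hy =>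
    by_cases hx0 : x = 0
    · simp [hx0]
    by_cases hy0 : y = 0
    · simp [hy0]
    obtain ⟨u, v, huv⟩ := hxy.isCoprime
    have hx1 := aeval_ne_zero hα hx0
    have hy1 := aeval_ne_zero hα hy0
    have : aeval α p / aeval α (x * y) =
        aeval α (p * u) / aeval α y + aeval α (p * v) / aeval α x := by
      have := congrArg (aeval α) huv
      simp only [map_add, map_mul, map_one] at this ⊢
      field_simp
      linear_combination (- aeval α p) * this
    rw [this]
    exact add_mem (hy _) (hx _)

end PartialFraction

/-! ### Gauss's lemma: passing between `F[α₁, …, αₙ]` and `K[αₙ]` -/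

namespace DiffField

open PartialFraction

variable {F : Type*} [Field F] {m : ℕ}

/-- This structure exhibits `K` as the fraction field of `F[α₁, …, αₙ₋₁]`, as Gauss's lemma
requires. -/
instance baseAlgebra : Algebra (MvPolynomial (Fin m) F) (Base F m) :=
  (MvPolynomial.aeval fun i : Fin m => (⟨alpha F m i.castSucc,
    IntermediateField.subset_adjoin F _ ⟨i, rfl⟩⟩ : Base F m)).toAlgebra

instance : Module (MvPolynomial (Fin m) F) (Base F m) := Algebra.toModule

instance : SMulZeroClass (MvPolynomial (Fin m) F) (Base F m) :=
  SMulWithZero.toSMulZeroClass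

/-- The polynomials in `α₁, …, αₙ`, as polynomials in `αₙ` with coefficients polynomials in
`α₁, …, αₙ₋₁`. -/
def splitLast (F : Type*) [Field F] (m : ℕ) : Poly F m ≃ₐ[F] (MvPolynomial (Fin m) F)[X] :=
  (MvPolynomial.renameEquiv F finSuccEquivLast).trans (MvPolynomial.optionEquivLeft F (Fin m))

theorem natDegree_splitLast (p : Poly F m) :
    (splitLast F m p).natDegree = p.degreeOf (Fin.last m) := by
  rw [splitLast, AlgEquiv.trans_apply, MvPolynomial.natDegree_optionEquivLeft,
    MvPolynomial.renameEquiv_apply, ← finSuccEquivLast_last,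
    MvPolynomial.degreeOf_rename_of_injective finSuccEquivLast.injective]

/-- The inclusion of `F[α₁, …, αₙ]` into `K[αₙ]`, where `K = F(α₁, …, αₙ₋₁)`. -/
def toBase (F : Type*) [Field F] (m : ℕ) : Poly F m →+* (Base F m)[X] :=
  (Polynomial.mapRingHom (algebraMap (MvPolynomial (Fin m) F) (Base F m))).comp
    (splitLast F m : Poly F m →+* (MvPolynomial (Fin m) F)[X])

theorem toBase_apply (p : Poly F m) : toBase F m p =
    (splitLast F m p).map (algebraMap (MvPolynomial (Fin m) F) (Base F m)) := rfl

theorem toBase_X_last : toBase F m (MvPolynomial.X (Fin.last m)) = Polynomial.X := by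
  simp [toBase_apply, splitLast]

theorem aeval_toBase (p : Poly F m) :
    Polynomial.aeval (alphaLast F m) (toBase F m p) = algebraMap (Poly F m) (RatField F m) p := by
  have : ((Polynomial.aeval (alphaLast F m)).toRingHom.comp (toBase F m)) =
      algebraMap (Poly F m) (RatField F m) := by
    apply MvPolynomial.ringHom_ext
    · intro r
      simp [toBase_apply, splitLast, RingHom.algebraMap_toAlgebra,
        IsScalarTower.algebraMap_apply F (Poly F m) (RatField F m), MvPolynomial.algebraMap_eq]
    · intro i
      refine Fin.lastCases ?_ (fun i => ?_) i
      · simp [toBase_X_last, alpha]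
      · simp [toBase_apply, splitLast, RingHom.algebraMap_toAlgebra, alpha]
  exact congrArg (fun g => g p) this

theorem algebraMap_injective : Function.Injective (algebraMap (Poly F m) (RatField F m)) :=
  IsFractionRing.injective _ _

theorem toBase_injective : Function.Injective (toBase F m) := fun p q h => by
  apply algebraMap_injective
  rw [← aeval_toBase, h, aeval_toBase]

theorem coe_algebraMap_base (r : MvPolynomial (Fin m) F) :
    ((algebraMap (MvPolynomial (Fin m) F) (Base F m) r : Base F m) : RatField F m) =
      MvPolynomial.aeval (fun i : Fin m => alpha F m i.castSucc) r := by
  rw [RingHom.algebraMap_toAlgebra]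
  exact (MvPolynomial.comp_aeval_apply
    (φ := (Base F m).val) (fun i : Fin m => (⟨alpha F m i.castSucc,
    IntermediateField.subset_adjoin F _ ⟨i, rfl⟩⟩ : Base F m)) r)

instance : FaithfulSMul (MvPolynomial (Fin m) F) (Base F m) := by
  rw [faithfulSMul_iff_algebraMap_injective]
  intro r s h
  apply Polynomial.C_injective
  apply (splitLast F m).symm.injective
  apply toBase_injective
  simp only [toBase_apply, AlgEquiv.apply_symm_apply, Polynomial.map_C, h]

instance : IsFractionRing (MvPolynomial (Fin m) F) (Base F m) := by
  refine IsFractionRing.of_field _ _ fun z => ?_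
  obtain ⟨r, s, h⟩ := (IntermediateField.mem_adjoin_range_iff F _ _).1 z.2
  exact ⟨r, s, Subtype.ext (by simpa [coe_algebraMap_base] using h)⟩

/-- Denominators of polynomials over `F(α₁, …, αₙ₋₁)` can be cleared. -/
theorem exists_toBase_eq (p : (Base F m)[X]) :
    ∃ q : Poly F m, ∃ b : Base F m, b ≠ 0 ∧ toBase F m q = Polynomial.C b * p := by
  obtain ⟨b, hb, h⟩ := IsLocalization.integerNormalization_spec
    (nonZeroDivisors (MvPolynomial (Fin m) F)) p
  refine ⟨(splitLast F m).symm (IsLocalization.integerNormalization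
    (nonZeroDivisors (MvPolynomial (Fin m) F)) p), algebraMap _ _ b,
    by simpa using nonZeroDivisors.ne_zero hb, ?_⟩
  rw [toBase_apply, AlgEquiv.apply_symm_apply]
  refine h.trans ?_
  ext1 i
  rw [Polynomial.coeff_smul, Polynomial.coeff_C_mul, Algebra.smul_def]

/-- Clearing denominators turns a relation over `K` into a polynomial over `F` that vanishes in the
fraction field, hence is zero. -/
theorem transcendental_alphaLast (F : Type*) [Field F] (m : ℕ) :
    Transcendental (Base F m) (alphaLast F m) := by
  rw [transcendental_iff]
  intro p hp
  obtain ⟨q, b, hb, h⟩ := exists_toBase_eq p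
  have hq : q = 0 := by
    apply algebraMap_injective
    rw [← aeval_toBase, h, map_mul, hp, mul_zero, map_zero]
  rw [hq, map_zero, eq_comm, mul_eq_zero, Polynomial.C_eq_zero] at h
  exact h.resolve_left hb

theorem natDegree_toBase (p : Poly F m) :
    (toBase F m p).natDegree = p.degreeOf (Fin.last m) := by
  rw [toBase_apply, Polynomial.natDegree_map_eq_of_injective
    (FaithfulSMul.algebraMap_injective _ _), natDegree_splitLast]

theorem isPrimitive_splitLast {d : Poly F m} (hd : Irreducible d)
    (hdeg : 1 ≤ d.degreeOf (Fin.last m)) : (splitLast F m d).IsPrimitive := by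
  refine ((MulEquiv.irreducible_iff (splitLast F m)).2 hd).isPrimitive ?_
  rw [natDegree_splitLast]
  omega

/-- Gauss's lemma: an irreducible of positive degree in `αₙ` is primitive, so it stays irreducible
over the fraction field of the coefficients. -/
theorem irreducible_toBase {d : Poly F m} (hd : Irreducible d)
    (hdeg : 1 ≤ d.degreeOf (Fin.last m)) : Irreducible (toBase F m d) := by
  let := UniqueFactorizationMonoid.strongNormalizationMonoid (α := MvPolynomial (Fin m) F)
  let := UniqueFactorizationMonoid.toNormalizedGCDMonoid (MvPolynomial (Fin m) F)
  exact (isPrimitive_splitLast hd hdeg).irreducible_iff_irreducible_map_fraction_map.1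
    ((MulEquiv.irreducible_iff (splitLast F m)).2 hd)

theorem dvd_of_toBase_dvd {d e : Poly F m} (hd : Irreducible d)
    (hdeg : 1 ≤ d.degreeOf (Fin.last m)) (h : toBase F m d ∣ toBase F m e) : d ∣ e := by
  let := UniqueFactorizationMonoid.strongNormalizationMonoid (α := MvPolynomial (Fin m) F)
  let := UniqueFactorizationMonoid.toNormalizedGCDMonoid (MvPolynomial (Fin m) F)
  exact (map_dvd_iff (splitLast F m)).1
    ((isPrimitive_splitLast hd hdeg).dvd_of_fraction_map_dvd_fraction_map h)

/-- Associates over `K` could differ by any nonzero element of `K`; primitivity brings the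
divisibility down to `F[α₁, …, αₙ]`, whose units are the constants of `F`. This is the ambiguity
allowed by `SigmaEquiv`. -/
theorem exists_smul_eq_of_toBase_associated {d e : Poly F m} (hd : Irreducible d)
    (he : Irreducible e) (hdeg : 1 ≤ d.degreeOf (Fin.last m))
    (h : Associated (toBase F m d) (toBase F m e)) : ∃ u : Fˣ, d = (u : F) • e := by
  obtain ⟨u, hu⟩ := (hd.associated_of_dvd he (dvd_of_toBase_dvd hd hdeg h.dvd)).symm
  obtain ⟨r, hr, hru⟩ := MvPolynomial.isUnit_iff_eq_C_of_isReduced.1 u.isUnit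
  refine ⟨hr.unit, ?_⟩
  rw [← hu, hru, MvPolynomial.smul_eq_C_mul, mul_comm, IsUnit.unit_spec]

theorem isUnit_toBase {d : Poly F m} (hd : d ≠ 0) (hdeg : d.degreeOf (Fin.last m) = 0) :
    IsUnit (toBase F m d) := by
  rw [Polynomial.isUnit_iff_degree_eq_zero, Polynomial.degree_eq_natDegree
    ((map_ne_zero_iff _ toBase_injective).2 hd), natDegree_toBase, hdeg, Nat.cast_zero]

/-- After clearing denominators, the prime `P` divides some irreducible factor `d`. Factors free of
`αₙ` become units over `K`, so `d` has positive degree. -/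
theorem exists_irreducible_toBase_associated {P : (Base F m)[X]} (hP : Irreducible P) :
    ∃ d : Poly F m, Irreducible d ∧ 1 ≤ d.degreeOf (Fin.last m) ∧
      Associated P (toBase F m d) := by
  obtain ⟨q, b, hb, h⟩ := exists_toBase_eq P
  have hq : q ≠ 0 := by
    rintro rfl
    rw [map_zero, eq_comm, mul_eq_zero, Polynomial.C_eq_zero] at h
    exact h.elim hb hP.ne_zero
  have hdvd : P ∣ toBase F m q := h ▸ dvd_mul_left _ _
  -- Only the divisibility passes to factors of `q`, so the exact equation is dropped before the
  -- induction.
  clear h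
  induction q using WfDvdMonoid.induction_on_irreducible with
  | zero => exact absurd rfl hq
  | unit u hu => exact absurd (isUnit_of_dvd_unit hdvd (hu.map _)) hP.not_isUnit
  | mul q d hq0 hd ih =>
    rw [map_mul] at hdvd
    rcases hP.prime.dvd_or_dvd hdvd with h | h
    · have hdeg : d.degreeOf (Fin.last m) ≠ 0 := fun h0 =>
        hP.not_isUnit (isUnit_of_dvd_unit h (isUnit_toBase hd.ne_zero h0))
      have hdeg' := Nat.one_le_iff_ne_zero.2 hdeg
      exact ⟨d, hd, hdeg', hP.associated_of_dvd (irreducible_toBase hd hdeg') h⟩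
    · exact ih hq0 h

/-! ### Grouping the components into the spaces `V_ω` -/

/-- The indices of the partial fraction components over `K` that make up `V_ω`. -/
def fiber (lam : Fin (m + 1) → Fˣ) : Omega lam → Set (ℕ ⊕ (MonicIrreducible (Base F m) × ℕ+))
  | Sum.inl i => {x | (∃ n : ℕ, x = Sum.inl n ∧ (n : ℤ) = i) ∨
      ∃ P j, x = Sum.inr (P, j) ∧ P.1 = Polynomial.X ∧ ((j : ℕ) : ℤ) = -i}
  | Sum.inr (O, j) => {x | ∃ P, ∃ d : Denom lam, x = Sum.inr (P, j) ∧
      (Quotient.mk _ d : Orbit lam) = O ∧ Associated P.1 (toBase F m d.1)}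

theorem not_associated_X_toBase {lam : Fin (m + 1) → Fˣ} (d : Denom lam) :
    ¬ Associated Polynomial.X (toBase F m d.1) := by
  rw [← toBase_X_last]
  intro h
  obtain ⟨u, hu⟩ := exists_smul_eq_of_toBase_associated d.2.1
    MvPolynomial.X_prime.irreducible d.2.2.1 h.symm
  exact d.2.2.2 ⟨0, u, by simpa using hu⟩

/-- Two denominators attached to the same `P` differ by a constant of `F`, so they are equivalent
with shift `0`; `P = X` belongs only to the powers of `αₙ`. -/
theorem fiber_disjoint (lam : Fin (m + 1) → Fˣ) {x : ℕ ⊕ (MonicIrreducible (Base F m) × ℕ+)}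
    {ω ω' : Omega lam} (h : x ∈ fiber lam ω) (h' : x ∈ fiber lam ω') : ω = ω' := by
  rcases ω with i | ⟨O, j⟩ <;> rcases ω' with i' | ⟨O', j'⟩
  · rcases h with ⟨n, rfl, h⟩ | ⟨P, j, rfl, hP, h⟩ <;>
      rcases h' with ⟨n', hn, h'⟩ | ⟨P', j', hn, hP', h'⟩ <;> cases hn
    · rw [← h, ← h']
    · rw [show i = i' by omega]
  · rcases h with ⟨n, rfl, h⟩ | ⟨P, j, rfl, hP, h⟩ <;>
      obtain ⟨Q, d, hQ, rfl, hd⟩ := h' <;> cases hQ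
    exact absurd (hP ▸ hd) (not_associated_X_toBase d)
  · rcases h' with ⟨n, rfl, h'⟩ | ⟨P, j, rfl, hP, h'⟩ <;>
      obtain ⟨Q, d, hQ, rfl, hd⟩ := h <;> cases hQ
    exact absurd (hP ▸ hd) (not_associated_X_toBase d)
  · obtain ⟨P, d, rfl, rfl, hd⟩ := h
    obtain ⟨Q, e, hQ, rfl, he⟩ := h'
    cases hQ
    obtain ⟨u, hu⟩ := exists_smul_eq_of_toBase_associated d.2.1 e.2.1 d.2.2.1 (hd.symm.trans he)
    have : (Quotient.mk _ d : Orbit lam) = Quotient.mk _ e :=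
      Quotient.sound ⟨0, u, by simpa using hu⟩
    rw [this]

theorem natDegree_eq_of_associated {P : (Base F m)[X]} {d : Poly F m}
    (h : Associated P (toBase F m d)) : P.natDegree = d.degreeOf (Fin.last m) := by
  rw [← natDegree_toBase]
  exact Polynomial.natDegree_eq_of_degree_eq (Polynomial.degree_eq_degree_of_associated h)

/-- The image of an admissible denominator under a power of `σ`. -/
def Denom.shift {lam : Fin (m + 1) → Fˣ} (d : Denom lam) (k : ℤ) : Denom lam :=
  ⟨(sigmaPoly lam ^ k) d.1, (MulEquiv.irreducible_iff (sigmaPoly lam ^ k)).2 d.2.1,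
    (degreeOf_sigmaPoly_zpow lam k d.1 _).symm ▸ d.2.2.1,
    fun h => d.2.2.2 (SigmaEquiv.trans ⟨k, 1, by simp⟩ h)⟩

/-- A generator `a / θ(d) ^ j` already lies in one component, indexed by the monic associate of the
shifted denominator. -/
theorem space_le (lam : Fin (m + 1) → Fˣ) (ω : Omega lam) :
    space lam ω ≤ ⨆ x ∈ fiber lam ω, component (K := Base F m) (alphaLast F m) x := by
  rcases ω with i | ⟨O, j⟩
  · refine (Submodule.span_singleton_le_iff_mem _ _).2 ?_
    rcases le_or_gt 0 i with hi | hi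
    · lift i to ℕ using hi
      refine (le_biSup (component (K := Base F m) (alphaLast F m))
        (show Sum.inl i ∈ fiber lam (Sum.inl (i : ℤ)) from
        Or.inl ⟨i, rfl, rfl⟩)) ?_
      rw [zpow_natCast]
      exact Submodule.mem_span_singleton_self _
    -- The exponent is `-(n + 1)`, so the power is the fraction `1 / X ^ (n + 1)`, with pole order
    -- `n.succPNat`.
    · obtain ⟨n, hn⟩ := Int.eq_negSucc_of_lt_zero hi
      refine (le_biSup (component (K := Base F m) (alphaLast F m)) (show Sum.inr (⟨Polynomial.X,
        Polynomial.monic_X, Polynomial.irreducible_X⟩, n.succPNat) ∈ fiber lam (Sum.inl i) from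
        Or.inr ⟨_, _, rfl, rfl, by rw [hn]; simp [Int.negSucc_eq]⟩)) ?_
      refine mem_component_inr.2 ⟨1, by simp, ?_⟩
      rw [hn, zpow_negSucc]
      simp
  · induction O using Quotient.inductionOn with
    | h d =>
      refine Submodule.span_le.2 ?_
      rintro x ⟨a, θ, ⟨k, rfl⟩, ha, rfl⟩
      have hirr := irreducible_toBase (d.shift k).2.1 (d.shift k).2.2.1
      obtain ⟨P, hP⟩ := exists_monicIrreducible hirr
      refine (le_biSup (component (K := Base F m) (alphaLast F m)) (show Sum.inr (P, j) ∈
        fiber lam (Sum.inr (Quotient.mk _ d, j)) from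
        ⟨P, d.shift k, rfl, Quotient.sound (SigmaEquiv.symm ⟨k, 1, by simp [Denom.shift]⟩), hP⟩)) ?_
      obtain ⟨b, hb, h⟩ := exists_div_eq_of_associated (transcendental_alphaLast F m) hP.symm
        P.2.2.ne_zero a j
      refine mem_component_inr.2 ⟨b, ?_, ?_⟩
      · rw [hb, natDegree_eq_of_associated hP]
        exact (degreeOf_sigmaPoly_zpow lam k d.1 (Fin.last m)).symm ▸ ha
      · rw [← h, aeval_toBase]
        exact congrArg (fun y => _ / y ^ (j : ℕ)) (sigma_zpow_algebraMap lam k d.1)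

theorem sigmaPoly_zpow_X (lam : Fin (m + 1) → Fˣ) (k : ℤ) (i : Fin (m + 1)) :
    ∃ u : Fˣ, (sigmaPoly lam ^ k) (MvPolynomial.X i) = (u : F) • MvPolynomial.X i := by
  have h1 : sigmaPoly lam (MvPolynomial.X i) = (lam i : F) • MvPolynomial.X i := by
    simp [sigmaPoly, MvPolynomial.smul_eq_C_mul]
  have h2 : (sigmaPoly lam)⁻¹ (MvPolynomial.X i) = ((lam i)⁻¹ : Fˣ).val • MvPolynomial.X i := by
    apply (sigmaPoly lam).injective
    rw [← AlgEquiv.mul_apply, mul_inv_cancel, map_smul, h1, smul_smul]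
    simp
  induction k with
  | zero => exact ⟨1, by simp⟩
  | succ k ih =>
    obtain ⟨u, hu⟩ := ih
    exact ⟨lam i * u, by rw [zpow_add_one, AlgEquiv.mul_apply, h1, map_smul, hu, smul_smul]; simp⟩
  | pred k ih =>
    obtain ⟨u, hu⟩ := ih
    exact ⟨(lam i)⁻¹ * u, by
      rw [zpow_sub_one, AlgEquiv.mul_apply, h2, map_smul, hu, smul_smul]; simp⟩

/-- Powers of `σ` only rescale `αₙ`, so the class excluded from the denominators consists of
constant multiples of `αₙ`; its fractions are the negative powers. -/
theorem associated_X_last {lam : Fin (m + 1) → Fˣ} {d : Poly F m}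
    (h : SigmaEquiv lam d (MvPolynomial.X (Fin.last m))) :
    Associated d (MvPolynomial.X (Fin.last m)) := by
  obtain ⟨k, u, h⟩ := h.symm
  obtain ⟨v, hv⟩ := sigmaPoly_zpow_X lam k (Fin.last m)
  have hd : d = ((u⁻¹ * v : Fˣ) : F) • MvPolynomial.X (Fin.last m) := by
    rw [Units.val_mul, mul_smul, ← hv, h, smul_smul]
    simp
  rw [hd, MvPolynomial.smul_eq_C_mul]
  exact associated_unit_mul_left _ _ ((u⁻¹ * v).isUnit.map MvPolynomial.C)

theorem exists_component_le (lam : Fin (m + 1) → Fˣ)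
    (x : ℕ ⊕ (MonicIrreducible (Base F m) × ℕ+)) :
    ∃ ω : Omega lam, component (K := Base F m) (alphaLast F m) x ≤ space lam ω := by
  rcases x with n | ⟨P, j⟩
  · refine ⟨Sum.inl n, ?_⟩
    change Submodule.span _ _ ≤ Submodule.span _ _
    rw [zpow_natCast]
  obtain ⟨d, hd, hdeg, hPd⟩ := exists_irreducible_toBase_associated P.2.2
  have hd0 : toBase F m d ≠ 0 := (map_ne_zero_iff _ toBase_injective).2 hd.ne_zero
  by_cases hdX : SigmaEquiv lam d (MvPolynomial.X (Fin.last m))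
  · have hX : P.1 = Polynomial.X := by
      refine Polynomial.eq_of_monic_of_associated P.2.1 Polynomial.monic_X (hPd.trans ?_)
      rw [← toBase_X_last]
      exact (associated_X_last hdX).map (toBase F m)
    refine ⟨Sum.inl (-(j : ℕ)), fun x hx => ?_⟩
    obtain ⟨a, ha, rfl⟩ := mem_component_inr.1 hx
    rw [hX, Polynomial.natDegree_X, Nat.cast_one] at ha
    rw [Polynomial.eq_C_of_degree_le_zero (Nat.WithBot.lt_one_iff_le_zero.1 ha), hX,
      Polynomial.aeval_C, Polynomial.aeval_X]
    refine Submodule.mem_span_singleton.2 ⟨a.coeff 0, ?_⟩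
    rw [Algebra.smul_def, zpow_neg, zpow_natCast, div_eq_mul_inv]
  · refine ⟨Sum.inr (Quotient.mk _ ⟨d, hd, hdeg, hdX⟩, j), fun x hx => ?_⟩
    obtain ⟨a, ha, rfl⟩ := mem_component_inr.1 hx
    obtain ⟨b, hb, h⟩ := exists_div_eq_of_associated (transcendental_alphaLast F m) hPd hd0 a j
    refine Submodule.subset_span ⟨b, 1, one_mem _, ?_, ?_⟩
    · rwa [hb, ← natDegree_eq_of_associated hPd]
    · rw [h, aeval_toBase, AlgEquiv.one_apply]

/-- Sums of an independent family over disjoint index sets are again independent. -/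
theorem iSupIndep_space (lam : Fin (m + 1) → Fˣ) : iSupIndep (space lam) := by
  intro ω
  refine ((iSupIndep_component (transcendental_alphaLast F m)).disjoint_biSup_biSup
    (s := fiber lam ω) (t := (fiber lam ω)ᶜ) disjoint_compl_right).mono (space_le lam ω) ?_
  refine iSup₂_le fun ω' hω' => (space_le lam ω').trans (biSup_mono fun x hx hx' => ?_)
  exact hω' (fiber_disjoint lam hx hx')

theorem iSup_space (lam : Fin (m + 1) → Fˣ) : ⨆ ω, space lam ω = ⊤ := by
  refine eq_top_iff.2 fun f _ => ?_
  have hle : ⨆ x, component (K := Base F m) (alphaLast F m) x ≤ ⨆ ω, space lam ω :=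
    iSup_le fun x => (exists_component_le lam x).elim fun ω h => h.trans (le_iSup _ ω)
  obtain ⟨p, q, _, rfl⟩ := IsFractionRing.div_surjective (Poly F m) f
  rw [← aeval_toBase, ← aeval_toBase]
  exact hle (div_mem_iSup_component (transcendental_alphaLast F m) _ _)

/-! ### Stability of the spaces `V_ω` under `σ` -/

theorem sigma_mem_base (lam : Fin (m + 1) → Fˣ) {x : RatField F m} (hx : x ∈ Base F m) :
    sigma lam x ∈ Base F m := by
  have : Base F m ≤ (Base F m).comap (sigma lam : RatField F m →ₐ[F] RatField F m) := by
    refine IntermediateField.adjoin_le_iff.2 ?_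
    rintro _ ⟨i, rfl⟩
    change sigma lam (alpha F m i.castSucc) ∈ Base F m
    rw [sigma_alpha]
    exact (Base F m).smul_mem (IntermediateField.subset_adjoin F _ ⟨i, rfl⟩)
  exact this hx

/-- The restriction of `σ` to `F(α₁, …, αₙ₋₁)`. -/
def sigmaBase (lam : Fin (m + 1) → Fˣ) : Base F m →+* Base F m :=
  ((sigma lam : RatField F m →+* RatField F m).comp (Base F m).val.toRingHom).codRestrict
    (Base F m) fun x => sigma_mem_base lam x.2

/-- `σ` acts on the coefficients and substitutes `λₙ αₙ` for `αₙ`, neither of which raises the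
degree. -/
theorem sigma_aeval (lam : Fin (m + 1) → Fˣ) (a : (Base F m)[X]) :
    ∃ b : (Base F m)[X], b.degree ≤ a.degree ∧
      sigma lam (Polynomial.aeval (alphaLast F m) a) = Polynomial.aeval (alphaLast F m) b := by
  refine ⟨(a.map (sigmaBase lam)).comp (Polynomial.C (algebraMap F (Base F m)
    (lam (Fin.last m))) * Polynomial.X), ?_, ?_⟩
  · refine Polynomial.degree_le_iff_coeff_zero _ _ |>.2 fun n hn => ?_
    rw [Polynomial.comp_C_mul_X_coeff, Polynomial.coeff_map,
      Polynomial.coeff_eq_zero_of_degree_lt hn, map_zero, zero_mul]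
  · rw [Polynomial.aeval_comp, Polynomial.aeval_def, Polynomial.aeval_def, Polynomial.eval₂_map]
    change (sigma lam : RatField F m →+* RatField F m) _ = _
    rw [Polynomial.hom_eval₂]
    congr 1
    change sigma lam _ = _
    rw [sigma_alpha, map_mul, Polynomial.aeval_C, Polynomial.aeval_X, Algebra.smul_def,
      ← IsScalarTower.algebraMap_apply]

/-- `σ` is only semilinear over `K`, but since it maps `K` into itself, stability of a span can be
checked on generators. -/
theorem sigma_mem_span (lam : Fin (m + 1) → Fˣ) {s : Set (RatField F m)}
    (h : ∀ x ∈ s, sigma lam x ∈ Submodule.span (Base F m) s) {x : RatField F m}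
    (hx : x ∈ Submodule.span (Base F m) s) : sigma lam x ∈ Submodule.span (Base F m) s := by
  induction hx using Submodule.span_induction with
  | mem x hx => exact h x hx
  | zero => simp
  | add x y _ _ hx hy => rw [map_add]; exact add_mem hx hy
  | smul a x _ hx =>
    have : sigma lam (a • x) = sigmaBase lam a • sigma lam x := by
      rw [Algebra.smul_def, map_mul, Algebra.smul_def]
      rfl
    rw [this]
    exact Submodule.smul_mem _ _ hx

theorem smul_mem_space (lam : Fin (m + 1) → Fˣ) (ω : Omega lam) (c : F) {x : RatField F m}
    (hx : x ∈ space lam ω) : c • x ∈ space lam ω := by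
  rw [← algebraMap_smul (Base F m) c x]
  exact Submodule.smul_mem _ _ hx

theorem sigma_mem_space (lam : Fin (m + 1) → Fˣ) (ω : Omega lam) {x : RatField F m}
    (hx : x ∈ space lam ω) : sigma lam x ∈ space lam ω := by
  rcases ω with i | ⟨O, j⟩
  · refine sigma_mem_span lam ?_ hx
    rintro _ rfl
    rw [map_zpow₀, sigma_alpha, Algebra.smul_def, mul_zpow, ← map_zpow₀, ← Algebra.smul_def,
      ← algebraMap_smul (Base F m)]
    exact Submodule.smul_mem _ _ (Submodule.mem_span_singleton_self _)
  · induction O using Quotient.inductionOn with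
    | h d =>
      refine sigma_mem_span lam ?_ hx
      rintro _ ⟨a, θ, hθ, ha, rfl⟩
      obtain ⟨b, hb, h⟩ := sigma_aeval lam a
      refine Submodule.subset_span ⟨b, sigma lam * θ,
        mul_mem (Subgroup.mem_zpowers _) hθ, hb.trans_lt ha, ?_⟩
      rw [map_div₀, h, map_pow, AlgEquiv.mul_apply]

/-! ### Orbital decompositions and summability -/

theorem IsOrbitalDecomposition.eq {lam : Fin (m + 1) → Fˣ} {f : RatField F m}
    {φ ψ : Omega lam →₀ RatField F m} (hφ : IsOrbitalDecomposition lam f φ)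
    (hψ : IsOrbitalDecomposition lam f ψ) : φ = ψ := by
  classical
  have h := (iSupIndep_iff_finsetSum_eq_imp_eq _).1 (iSupIndep_space lam)
    (φ.support ∪ ψ.support) φ ψ (fun ω _ => ⟨hφ.1 ω, hψ.1 ω⟩) (by
      rw [← Finsupp.sum_of_support_subset φ Finset.subset_union_left (fun _ x => x) (by simp),
        ← Finsupp.sum_of_support_subset ψ Finset.subset_union_right (fun _ x => x) (by simp),
        ← hφ.2, ← hψ.2])
  ext ω
  by_cases hω : ω ∈ φ.support ∪ ψ.support
  · exact h ω hω
  · simp only [Finset.mem_union, Finsupp.mem_support_iff, not_or, not_not] at hω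
    rw [hω.1, hω.2]

theorem exists_isOrbitalDecomposition (lam : Fin (m + 1) → Fˣ) (f : RatField F m) :
    ∃ φ : Omega lam →₀ RatField F m, IsOrbitalDecomposition lam f φ := by
  obtain ⟨φ, hφ, h⟩ := (Submodule.mem_iSup_iff_exists_finsupp _ f).1
    (iSup_space lam ▸ Submodule.mem_top : f ∈ ⨆ ω, space lam ω)
  exact ⟨φ, hφ, h.symm⟩

/-- The decomposition of `c σ(g) - g` is obtained componentwise from that of `g`. -/
theorem IsOrbitalDecomposition.smul_sigma_sub {lam : Fin (m + 1) → Fˣ} (c : F)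
    {g : RatField F m} {γ : Omega lam →₀ RatField F m} (h : IsOrbitalDecomposition lam g γ) :
    IsOrbitalDecomposition lam (c • sigma lam g - g)
      (γ.mapRange (fun x => c • sigma lam x - x) (by simp)) := by
  refine ⟨fun ω => ?_, ?_⟩
  · rw [Finsupp.mapRange_apply]
    exact sub_mem (smul_mem_space lam ω c (sigma_mem_space lam ω (h.1 ω))) (h.1 ω)
  · rw [Finsupp.sum_mapRange_index (by simp), h.2]
    simp only [Finsupp.sum, map_sum, Finset.smul_sum, Finset.sum_sub_distrib]

end DiffField

end

theorem mainTheorem4 {F : Type*} [Field F] (m : ℕ) (lam : Fin (m + 1) → Fˣ) (c : F) (hc : c ≠ 0)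
    (f : DiffField.RatField F m) :
    (∃! φ : DiffField.Omega lam →₀ DiffField.RatField F m,
      DiffField.IsOrbitalDecomposition lam f φ) ∧
    ∀ φ : DiffField.Omega lam →₀ DiffField.RatField F m,
      DiffField.IsOrbitalDecomposition lam f φ →
        (DiffField.IsSummable lam c f ↔
          ∀ ω : DiffField.Omega lam,
            DiffField.IsSummableIn lam c (DiffField.space lam ω) (φ ω)) := by
  obtain ⟨φ₀, hφ₀⟩ := DiffField.exists_isOrbitalDecomposition lam f
  refine ⟨⟨φ₀, hφ₀, fun ψ hψ => hψ.eq hφ₀⟩, fun φ hφ => ⟨?_, fun h => ?_⟩⟩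
  · rintro ⟨g, rfl⟩ ω
    obtain ⟨γ, hγ⟩ := DiffField.exists_isOrbitalDecomposition lam g
    refine ⟨γ ω, hγ.1 ω, ?_⟩
    -- By uniqueness, `φ` is the componentwise image of the decomposition of `g`.
    rw [hφ.eq (hγ.smul_sigma_sub c), Finsupp.mapRange_apply]
  · choose g _ hg using h
    refine ⟨∑ ω ∈ φ.support, g ω, ?_⟩
    rw [hφ.2, map_sum, Finset.smul_sum, ← Finset.sum_sub_distrib]
    exact Finset.sum_congr rfl fun ω _ => hg ω
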